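/- Let $M$ be a finite-dimensional, Hausdorff, second countable smooth manifold without boundary. Let $C^\infty(M)$ be the ${}^*$-algebra of smooth complex-valued functions on $M$ with pointwise operations, complex conjugation as involution, and the pointwise order. Assume that $M$ is a Poisson manifold, i.e. that $C^\infty(M)$ carries a $\mathbb C$-bilinear antisymmetric bracket $\{\cdot,\cdot\}$ that satisfies the Leibniz and Jacobi identities and $\overline{\{f,h\}}=\{\overline f,\overline h\}$. Let $G$ be a (finite-dimensional) connected abelian Lie group with Lie algebra $\mathfrak g$, acting smoothly from the left on $M$. For $f\in C^\infty(M)$ and $\xi\in\mathfrak g$ let $f\triangleleft\xi\in C^\infty(M)$ be the function whose value at $x\in M$ is the derivative at $1\in G$, in the direction $\xi$, of the map $g\mapsto f(g\cdot x)$. Assume that this action of $\mathfrak g$ is induced by a momentum map, i.e. that a morphism of real Lie algebras $J$ from $\mathfrak g$ to the real-valued functions in $C^\infty(M)$ (with the Poisson bracket) is given with $f\triangleleft\xi=\{f,J(\xi)\}$ for all $f\in C^\infty(M)$, $\xi\in\mathfrak g$. Let $C^\infty(M)^{\mathfrak g}=\{f\in C^\infty(M) : f\triangleleft\xi=0 \text{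 for all } \xi\in\mathfrak g\}$. If the action of $G$ on $M$ is proper (i.e. the map $G\times M\to M\times M$, $(g,x)\mapsto(g\cdot x,x)$ is proper), then there exists an averaging operator $C^\infty(M)\to C^\infty(M)^{\mathfrak g}$, i.e. a $\mathbb C$-linear map $f\mapsto f_{\mathrm{av}}$ from $C^\infty(M)$ to $C^\infty(M)^{\mathfrak g}$ such that 1. $f_{\mathrm{av}}=f$ for all $f\in C^\infty(M)^{\mathfrak g}$; 2. $f_{\mathrm{av}}$ is real-valued for every real-valued $f\in C^\infty(M)$; 3. $f_{\mathrm{av}}\ge 0$ pointwise for every $f\in C^\infty(M)$ with $f\ge 0$ pointwise. -/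

import Mathlib

open scoped Manifold ContDiff

noncomputable section

/-! ### Ordered and representable Poisson `*`-algebras -/

section Algebra

variable {A : Type*} [Ring A] [StarRing A] [Algebra ℂ A] [StarModule ℂ A]

/-- A quadratic module on a `*`-algebra. -/
structure IsQuadraticModule (Q : Set A) : Prop where
  isSelfAdjoint : ∀ a ∈ Q, IsSelfAdjoint a
  add_mem : ∀ a ∈ Q, ∀ b ∈ Q, a + b ∈ Q
  conj_mem : ∀ a ∈ Q, ∀ d : A, star d * a * d ∈ Q
  one_mem : (1 : A) ∈ Q

/-- A state on a `*`-algebra whose set of positive Hermitian elements is `Q`: a normalized, Hermitian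
linear functional that is positive on `Q`. (Hermitian functionals take real values on Hermitian
elements, hence on `Q`.) -/
structure IsStateOn (Q : Set A) (φ : A →ₗ[ℂ] ℂ) : Prop where
  map_one : φ 1 = 1
  map_star : ∀ a, φ (star a) = star (φ a)
  nonneg : ∀ a ∈ Q, 0 ≤ (φ a).re

variable (A) in
/-- A Poisson bracket on a `*`-algebra, compatible with the involution. -/
structure PoissonBracket where
  bracket : A →ₗ[ℂ] A →ₗ[ℂ] A
  antisymm : ∀ a b, bracket a b = -bracket b a
  leibniz : ∀ a b c, bracket (a * b) c = bracket a c * b + a * bracket b c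
  jacobi : ∀ a b c,
    bracket a (bracket b c) + bracket b (bracket c a) + bracket c (bracket a b) = 0
  map_star : ∀ a b, star (bracket a b) = bracket (star a) (star b)

variable (A) in
/-- A representable Poisson `*`-algebra structure on a `*`-algebra `A`: a Poisson bracket together
with an order, given by its set `pos` of positive Hermitian elements (`a ≤ b` means
`b - a ∈ pos`), which is antisymmetric and induced by its states. -/
structure RepresentablePoisson extends PoissonBracket A where
  pos : Set A
  isQuadraticModule : IsQuadraticModule pos
  pos_antisymm : ∀ a ∈ pos, -a ∈ pos → a = 0
  induced_by_states : ∀ a, IsSelfAdjoint a →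
    (∀ φ : A →ₗ[ℂ] ℂ, IsStateOn pos φ → 0 ≤ (φ a).re) → a ∈ pos

/-- A momentum map `J : 𝔤 → A_H`: a morphism of real Lie algebras into the Hermitian elements of `A`
with the Poisson bracket. -/
structure MomentumMap (P : RepresentablePoisson A) (𝔤 : Type*) [LieRing 𝔤] [LieAlgebra ℝ 𝔤] where
  toFun : 𝔤 →ₗ[ℝ] A
  isSelfAdjoint : ∀ ξ, IsSelfAdjoint (toFun ξ)
  map_lie : ∀ ξ η, toFun ⁅ξ, η⁆ = P.bracket (toFun ξ) (toFun η)

variable {P : RepresentablePoisson A} {𝔤 : Type*} [LieRing 𝔤] [LieAlgebra ℝ 𝔤]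

/-- The right action of `𝔤` on `A` induced by a momentum map. -/
def MomentumMap.act (J : MomentumMap P 𝔤) (a : A) (ξ : 𝔤) : A :=
  P.bracket a (J.toFun ξ)

/-- The unital `*`-subalgebra of `𝔤`-invariant elements of `A`. -/
def MomentumMap.invariants (J : MomentumMap P 𝔤) : StarSubalgebra ℂ A where
  carrier := {a | ∀ ξ, J.act a ξ = 0}
  mul_mem' {a b} ha hb ξ := by
    have h1 : P.bracket a (J.toFun ξ) = 0 := ha ξ
    have h2 : P.bracket b (J.toFun ξ) = 0 := hb ξ
    simp [MomentumMap.act, P.leibniz, h1, h2]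
  add_mem' {a b} ha hb ξ := by
    have h1 : P.bracket a (J.toFun ξ) = 0 := ha ξ
    have h2 : P.bracket b (J.toFun ξ) = 0 := hb ξ
    simp [MomentumMap.act, h1, h2]
  algebraMap_mem' r ξ := by
    have h : P.bracket 1 (J.toFun ξ) = 0 := by simpa using P.leibniz 1 1 (J.toFun ξ)
    simp [MomentumMap.act, Algebra.algebraMap_eq_smul_one, h]
  star_mem' {a} ha ξ := by
    have h1 : P.bracket a (J.toFun ξ) = 0 := ha ξ
    have h2 := P.map_star a (J.toFun ξ)
    rw [h1, star_zero, (J.isSelfAdjoint ξ).star_eq] at h2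
    exact h2.symm

/-- Averaging operators for the action of `𝔤` on `A` induced by a momentum map: linear maps
`A → A^𝔤` that are projections onto `A^𝔤`, Hermitian, and positive. Here `A^𝔤` carries the
restricted order. -/
structure IsAveragingOperator (J : MomentumMap P 𝔤) (av : A →ₗ[ℂ] J.invariants) : Prop where
  apply_of_mem : ∀ a : J.invariants, av (a : A) = a
  hermitian : ∀ a : A, IsSelfAdjoint a → IsSelfAdjoint (av a)
  positive : ∀ a ∈ P.pos, (av a : A) ∈ P.pos

end Algebra

/-! ### Smooth functions on a Poisson manifold -/

section Manifold

variable (E : Type*) [NormedAddCommGroup E] [NormedSpace ℝ E]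
  (M : Type*) [TopologicalSpace M] [ChartedSpace E M]

/-- The `*`-algebra `C^∞(M)` of smooth complex-valued functions on a manifold `M` modelled on `E`,
with the pointwise operations. -/
def SmoothFun : StarSubalgebra ℂ (M → ℂ) where
  carrier := {f | ContMDiff 𝓘(ℝ, E) 𝓘(ℝ, ℂ) ∞ f}
  mul_mem' {f g} hf hg := by
    have hf' : ContMDiff 𝓘(ℝ, E) 𝓘(ℝ, ℂ) ∞ f := hf
    have hg' : ContMDiff 𝓘(ℝ, E) 𝓘(ℝ, ℂ) ∞ g := hg
    exact (contDiff_mul (𝕜 := ℝ) (𝔸 := ℂ)).contMDiff.comp (hf'.prodMk_space hg')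
  add_mem' {f g} hf hg := by
    have hf' : ContMDiff 𝓘(ℝ, E) 𝓘(ℝ, ℂ) ∞ f := hf
    have hg' : ContMDiff 𝓘(ℝ, E) 𝓘(ℝ, ℂ) ∞ g := hg
    exact hf'.add hg'
  algebraMap_mem' _ := contMDiff_const
  star_mem' {f} hf := by
    have hf' : ContMDiff 𝓘(ℝ, E) 𝓘(ℝ, ℂ) ∞ f := hf
    exact (Complex.conjCLE : ℂ →L[ℝ] ℂ).contDiff.contMDiff.comp hf'

variable {E M}

/-- The pointwise positive elements of `C^∞(M)`. -/
def SmoothFun.pos : Set (SmoothFun E M) :=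
  {f | ∀ x, ((f : M → ℂ) x).im = 0 ∧ 0 ≤ ((f : M → ℂ) x).re}

/-- The evaluation functional at a point. -/
def SmoothFun.eval (x : M) : SmoothFun E M →ₗ[ℂ] ℂ where
  toFun f := (f : M → ℂ) x
  map_add' _ _ := rfl
  map_smul' _ _ := rfl

/-- `C^∞(M)` with the pointwise order and a given Poisson bracket is a representable Poisson
`*`-algebra. A Poisson bracket on the real-valued smooth functions (a Poisson structure on `M`)
is the same thing as a Poisson bracket on `C^∞(M)` compatible with complex conjugation. -/
def SmoothFun.representablePoisson (π : PoissonBracket (SmoothFun E M)) :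
    RepresentablePoisson (SmoothFun E M) where
  toPoissonBracket := π
  pos := SmoothFun.pos
  isQuadraticModule :=
    { isSelfAdjoint := by
        intro f hf
        ext x
        exact Complex.conj_eq_iff_im.2 (hf x).1
      add_mem := by
        intro f hf g hg x
        exact ⟨by simp [(hf x).1, (hg x).1], by simpa using add_nonneg (hf x).2 (hg x).2⟩
      conj_mem := by
        intro f hf d x
        have h1 := (hf x).1
        have h2 := (hf x).2
        constructor
        · simp [h1]; ring
        · simp [h1]
          nlinarith [mul_nonneg h2 (mul_self_nonneg ((d : M → ℂ) x).re),
            mul_nonneg h2 (mul_self_nonneg ((d : M → ℂ) x).im)]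
      one_mem := by
        intro x
        simp }
  pos_antisymm := by
    intro f hf hf'
    ext x
    have h := (hf' x).2
    apply Complex.ext
    · have h2 := (hf x).2
      simp at h ⊢
      linarith
    · simpa using (hf x).1
  induced_by_states := by
    intro f hf h x
    constructor
    · have := congrArg (fun g : SmoothFun E M => (g : M → ℂ) x) hf.star_eq
      exact Complex.conj_eq_iff_im.1 this
    · exact h (SmoothFun.eval x) ⟨rfl, fun _ => rfl, fun a ha => (ha x).2⟩

/-- The derivative at the identity of `g ↦ (f ◁ g)(x) = f (g • x)` in the direction `ξ`: the value
at `x` of `f ◁ ξ`, for the right action of the Lie algebra of `G` on `C^∞(M)` obtained by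
differentiating the right action of `G` by pullbacks. -/
def SmoothFun.infinitesimalAction {F : Type*} [NormedAddCommGroup F] [NormedSpace ℝ F]
    {G : Type*} [TopologicalSpace G] [ChartedSpace F G] [Group G] [MulAction G M]
    (f : SmoothFun E M) (ξ : GroupLieAlgebra 𝓘(ℝ, F) G) (x : M) : ℂ :=
  mfderiv 𝓘(ℝ, F) 𝓘(ℝ, ℂ) (fun g : G => (f : M → ℂ) (g • x)) 1 ξ

end Manifold

/-- Smooth real Lie groups have a Lie algebra in Mathlib's sense. -/
instance instLEInftyMinSmoothnessRealThree : ENat.LEInfty (minSmoothness ℝ 3) :=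
  ⟨by
    rw [minSmoothness_of_isRCLikeNormedField]
    exact ENat.LEInfty.out⟩

end

/-! Fix a Haar measure `μ` on `G`. For a compactly supported smooth `φ`, properness makes the orbit
integral `x ↦ ∫ φ (g • x) ∂μ` converge and, near each point, reduces it to an integral over one
compact subset of `G`. Hence it is smooth (`contMDiff_orbitIntegral`), and it is invariant since `G`
is abelian (`orbitIntegral_smul`).

For arbitrary smooth `f`, put `f_av x = ∑ᶠ i, w i x * ∫ φ i (g • x) * f (g • x) ∂μ`, where the `φ i
≥ 0` are smooth cutoffs with compact support and the `w i ≥ 0` are smooth, invariant, locally finite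
and normalized so that the average of 1 is 1. Invariance, reality and positivity are read off the
formula, and an invariant `f` factors out of it. The weights (`AveragingWeights.nonempty`) are
constructed on `M` itself, without passing to the quotient `M / G`.

Connectedness of `G` identifies functions killed by the Lie algebra with `G`-invariant ones
(`SmoothFun.smul_eq_of_infinitesimalAction_eq_zero`). The Poisson structure enters only through
`hJ`. -/

open MeasureTheory Set Topology Filter

/-! ### Differentiation under an integral over a compact set -/

section ParametricIntegral

variable {X : Type*} [TopologicalSpace X] {E : Type*} [NormedAddCommGroup E]
  {H : Type*} [NormedAddCommGroup H]

lemma ContinuousOn.slice {U : Set E} {F : E → X → H}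
    (hF : ContinuousOn F.uncurry (U ×ˢ univ)) {y : E} (hy : y ∈ U) : Continuous (F y) :=
  continuousOn_univ.1 <|
    hF.comp (f := fun x ↦ (y, x)) (by fun_prop) fun x _ ↦ ⟨hy, mem_univ _⟩

lemma ContinuousOn.exists_bound_nhds_slice {K : Set X} (hK : IsCompact K) {U : Set E}
    (hU : IsOpen U) {F : E → X → H}
    (hF : ContinuousOn F.uncurry (U ×ˢ univ)) {y : E} (hy : y ∈ U) :
    ∃ C, ∀ᶠ y' in 𝓝 y, ∀ x ∈ K, ‖F y' x‖ ≤ C := by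
  obtain ⟨C, hC⟩ := hK.exists_bound_of_continuousOn (hF.slice hy).continuousOn
  -- The slack 1 turns the bound at `y` into an open condition, which compactness of `K` spreads to
  -- a neighbourhood of `y`.
  refine ⟨C + 1, hK.eventually_forall_of_forall_eventually fun x hx ↦ ?_⟩
  have hc : ContinuousAt F.uncurry (y, x) :=
    hF.continuousAt ((hU.prod isOpen_univ).mem_nhds ⟨hy, mem_univ _⟩)
  have hlt : ‖F.uncurry (y, x)‖ < C + 1 := (hC x hx).trans_lt (lt_add_one C)
  exact (hc.norm.eventually_lt_const hlt).mono fun z hz ↦ hz.le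

variable [MeasurableSpace X] [OpensMeasurableSpace X] {μ : Measure X}

lemma ContinuousOn.aestronglyMeasurable_slice {K : Set X} (hK : IsCompact K)
    (hKm : MeasurableSet K) {U : Set E} {F : E → X → H}
    (hF : ContinuousOn F.uncurry (U ×ˢ univ)) {y : E} (hy : y ∈ U) :
    AEStronglyMeasurable (F y) (μ.restrict K) :=
  (hF.slice hy).continuousOn.aestronglyMeasurable_of_isCompact hK hKm

variable [IsFiniteMeasureOnCompacts μ]

lemma ContinuousOn.integrableOn_slice {K : Set X} (hK : IsCompact K) (hKm : MeasurableSet K)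
    {U : Set E} {F : E → X → H} (hF : ContinuousOn F.uncurry (U ×ˢ univ)) {y : E} (hy : y ∈ U) :
    IntegrableOn (F y) K μ := by
  refine ⟨hF.aestronglyMeasurable_slice hK hKm hy, ?_⟩
  obtain ⟨C, hC⟩ := hK.exists_bound_of_continuousOn (hF.slice hy).continuousOn
  exact HasFiniteIntegral.restrict_of_bounded C hK.measure_lt_top
    ((ae_restrict_iff' hKm).2 (.of_forall hC))

variable [NormedSpace ℝ H]

lemma ContinuousOn.continuousOn_setIntegral_slice {K : Set X} (hK : IsCompact K)
    (hKm : MeasurableSet K) {U : Set E} (hU : IsOpen U) {F : E → X → H}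
    (hF : ContinuousOn F.uncurry (U ×ˢ univ)) :
    ContinuousOn (fun y ↦ ∫ x in K, F y x ∂μ) U := by
  intro y hy
  obtain ⟨C, hC⟩ := hF.exists_bound_nhds_slice hK hU hy
  refine (continuousAt_of_dominated (bound := fun _ ↦ C) ?_ ?_ ?_ ?_).continuousWithinAt
  · filter_upwards [hU.mem_nhds hy] with y' hy'
    exact hF.aestronglyMeasurable_slice hK hKm hy'
  · filter_upwards [hC] with y' hy'
    exact (ae_restrict_iff' hKm).2 (.of_forall hy')
  · exact integrableOn_const hK.measure_ne_top
  · refine .of_forall fun x ↦ ?_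
    have hc : ContinuousAt F.uncurry (y, x) :=
      hF.continuousAt ((hU.prod isOpen_univ).mem_nhds ⟨hy, mem_univ _⟩)
    exact hc.comp (f := fun y' ↦ (y', x)) (by fun_prop)

variable [NormedSpace ℝ E]

/-- Differentiation under the integral sign, for Taylor series that depend continuously on the
integration variable, over a compact set. -/
theorem hasFTaylorSeriesUpToOn_setIntegral {K : Set X} (hK : IsCompact K)
    (hKm : MeasurableSet K) {U : Set E} (hU : IsOpen U) {F : E → X → H}
    {p : X → E → FormalMultilinearSeries ℝ E H}
    (hp : ∀ x, HasFTaylorSeriesUpToOn ∞ (fun y ↦ F y x) (p x) U)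
    (hc : ∀ m, ContinuousOn (Function.uncurry fun y x ↦ p x y m) (U ×ˢ univ)) :
    HasFTaylorSeriesUpToOn ∞ (fun y ↦ ∫ x in K, F y x ∂μ)
      (fun y m ↦ ∫ x in K, p x y m ∂μ) U where
  zero_eq y hy := by
    have h := (continuousMultilinearCurryFin0 ℝ E H).toContinuousLinearEquiv.integral_comp_comm
      (μ := μ.restrict K) (fun x ↦ p x y 0)
    refine h.symm.trans (setIntegral_congr_fun hKm fun x _ ↦ (hp x).zero_eq y hy)
  fderivWithin m _ y hy := by
    obtain ⟨C, hC⟩ := (hc (m + 1)).exists_bound_nhds_slice hK hU hy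
    -- Currying is a continuous linear equivalence, so it commutes with the integral without
    -- integrability or completeness of `H`.
    have hcl : (∫ x in K, p x y (m + 1) ∂μ).curryLeft =
        ∫ x in K, (p x y (m + 1)).curryLeft ∂μ := by
      let L : (E [×m + 1]→L[ℝ] H) ≃L[ℝ] (E →L[ℝ] E [×m]→L[ℝ] H) :=
        (continuousMultilinearCurryLeftEquiv ℝ (fun _ : Fin (m + 1) ↦ E) H).toContinuousLinearEquiv
      exact (ContinuousLinearEquiv.integral_comp_comm (𝕜 := ℝ) (E := E [×m + 1]→L[ℝ] H)
        (F := E →L[ℝ] E [×m]→L[ℝ] H) (μ := μ.restrict K) L fun x ↦ p x y (m + 1)).symm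
    have hcc : ContinuousOn (Function.uncurry fun y x ↦ (p x y (m + 1)).curryLeft)
        (U ×ˢ univ) :=
      (continuousMultilinearCurryLeftEquiv ℝ (fun _ : Fin (m + 1) ↦ E)
        H).continuous.comp_continuousOn (hc (m + 1))
    change HasFDerivWithinAt (fun y ↦ ∫ x in K, p x y m ∂μ)
      (∫ x in K, p x y (m + 1) ∂μ).curryLeft U y
    rw [hcl]
    refine (hasFDerivAt_integral_of_dominated_of_fderiv_le (bound := fun _ ↦ C)
      (F := fun y x ↦ p x y m) (F' := fun y x ↦ (p x y (m + 1)).curryLeft)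
      (hC.and (hU.mem_nhds hy)) ?_ ?_ ?_ ?_ ?_ ?_).hasFDerivWithinAt
    · filter_upwards [hU.mem_nhds hy] with y' hy'
      exact (hc m).aestronglyMeasurable_slice hK hKm hy'
    · exact (hc m).integrableOn_slice hK hKm hy
    · exact ContinuousOn.aestronglyMeasurable_slice (H := E →L[ℝ] E [×m]→L[ℝ] H) hK hKm
        (F := fun y x ↦ (p x y (m + 1)).curryLeft) hcc hy
    · refine (ae_restrict_iff' hKm).2 (.of_forall fun x hx y' hy' ↦ ?_)
      rw [ContinuousMultilinearMap.curryLeft_norm]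
      exact hy'.1 x hx
    · exact integrableOn_const hK.measure_ne_top
    · refine .of_forall fun x y' hy' ↦ ?_
      exact ((hp x).fderivWithin m (by exact_mod_cast ENat.natCast_lt_top m) y' hy'.2).hasFDerivAt
        (hU.mem_nhds hy'.2)
  cont m _ := (hc m).continuousOn_setIntegral_slice hK hKm hU

end ParametricIntegral

/-! ### Iterated partial derivatives -/

section PartialDerivatives

variable {V : Type*} [NormedAddCommGroup V] [NormedSpace ℝ V]
  {E : Type*} [NormedAddCommGroup E] [NormedSpace ℝ E]
  {H : Type*} [NormedAddCommGroup H] [NormedSpace ℝ H]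

lemma iteratedFDerivWithin_slice {f : E × V → H} {U : Set E} {T : Set V} (hU : IsOpen U)
    (hT : IsOpen T) (hf : ContDiffOn ℝ ∞ f (U ×ˢ T)) (m : ℕ) {y : E} {v : V} (hy : y ∈ U)
    (hv : v ∈ T) :
    iteratedFDerivWithin ℝ m (fun y ↦ f (y, v)) U y =
      (iteratedFDerivWithin ℝ m f (U ×ˢ T) (y, v)).compContinuousLinearMap
        fun _ ↦ ContinuousLinearMap.inl ℝ E V := by
  -- The slice at `v` is affine; translating by `(0, v)` makes it the linear map `inl`, to which the
  -- chain rule for iterated derivatives applies.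
  have hT' : IsOpen ((· + v) ⁻¹' T) := hT.preimage (by fun_prop)
  have hg : ContDiffOn ℝ ∞ (fun z ↦ f (z + (0, v))) (U ×ˢ ((· + v) ⁻¹' T)) :=
    hf.comp (f := fun z ↦ z + (0, v)) (by fun_prop) fun z hz ↦ ⟨by simpa using hz.1, hz.2⟩
  have hpre : ContinuousLinearMap.inl ℝ E V ⁻¹' (U ×ˢ ((· + v) ⁻¹' T)) = U := by
    ext; simp [hv]
  have h := (ContinuousLinearMap.inl ℝ E V).iteratedFDerivWithin_comp_right hg
    (hU.prod hT').uniqueDiffOn (by rw [hpre]; exact hU.uniqueDiffOn) (x := y) (i := m)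
    (by simp [hy, hv])
    (by exact_mod_cast le_top)
  rw [hpre, iteratedFDerivWithin_of_isOpen m (hU.prod hT') (by simp [hy, hv]),
    iteratedFDeriv_comp_add_right] at h
  rw [iteratedFDerivWithin_of_isOpen m (hU.prod hT) ⟨hy, hv⟩]
  simpa [Function.comp_def] using h

lemma ContDiffOn.continuousOn_iteratedFDerivWithin_slice {f : E × V → H} {U : Set E} {T : Set V}
    (hU : IsOpen U) (hT : IsOpen T) (hf : ContDiffOn ℝ ∞ f (U ×ˢ T)) (m : ℕ) :
    ContinuousOn (fun z : E × V ↦ iteratedFDerivWithin ℝ m (fun y ↦ f (y, z.2)) U z.1)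
      (U ×ˢ T) := by
  have h := hf.continuousOn_iteratedFDerivWithin (m := m) (by exact_mod_cast le_top)
    (hU.prod hT).uniqueDiffOn
  refine ((ContinuousMultilinearMap.compContinuousLinearMapL
    fun _ ↦ ContinuousLinearMap.inl ℝ E V).continuous.comp_continuousOn h).congr fun z hz ↦ ?_
  exact iteratedFDerivWithin_slice hU hT hf m hz.1 hz.2

end PartialDerivatives

/-! ### Orbit integrals -/

section OrbitIntegral

/-- The integral of a function along the orbits of a group action. -/
noncomputable def orbitIntegral {G M : Type*} [SMul G M] [MeasurableSpace G] (μ : Measure G)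
    (φ : M → ℂ) (x : M) : ℂ :=
  ∫ g, φ (g • x) ∂μ

section Topological

variable {G M : Type*} [Group G] [TopologicalSpace G] [TopologicalSpace M] [MulAction G M]
  [ProperSMul G M]

/-- This is where properness enters: the preimage of `tsupport φ ×ˢ K` under `(g, x) ↦ (g • x, x)`
is compact, and `L` is its projection to `G`. -/
lemma HasCompactSupport.exists_isCompact_smul_eq_zero {φ : M → ℂ} (hφ : HasCompactSupport φ)
    {K : Set M} (hK : IsCompact K) :
    ∃ L : Set G, IsCompact L ∧ ∀ x ∈ K, ∀ g ∉ L, φ (g • x) = 0 := by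
  refine ⟨_, ((ProperSMul.isProperMap_smul_pair (G := G) (X := M)).isCompact_preimage
    (hφ.prod hK)).image continuous_fst, fun x hx g hg ↦ ?_⟩
  by_contra h
  exact hg ⟨(g, x), ⟨subset_tsupport φ h, hx⟩, rfl⟩

lemma HasCompactSupport.comp_orbitMap [T2Space G] {φ : M → ℂ} (hφ : HasCompactSupport φ) (x : M) :
    HasCompactSupport fun g : G ↦ φ (g • x) := by
  obtain ⟨L, hL, h⟩ := hφ.exists_isCompact_smul_eq_zero (G := G) (isCompact_singleton (x := x))
  exact .intro hL fun g hg ↦ h x rfl g hg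

variable [MeasurableSpace G] [BorelSpace G] [T2Space G] (μ : Measure G)

lemma orbitIntegrable [IsFiniteMeasureOnCompacts μ] {φ : M → ℂ} (hc : Continuous φ)
    (hφ : HasCompactSupport φ) (x : M) : Integrable (fun g : G ↦ φ (g • x)) μ :=
  (hc.comp (by fun_prop)).integrable_of_hasCompactSupport (hφ.comp_orbitMap x)

lemma orbitIntegral_ofReal_pos [IsFiniteMeasureOnCompacts μ] [μ.IsOpenPosMeasure] {φ : M → ℝ}
    (hc : Continuous φ) (hφ : HasCompactSupport φ) (h0 : 0 ≤ φ) {x : M} (hx : φ x ≠ 0) :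
    0 < ∫ g, φ (g • x) ∂μ := by
  have hφ' : HasCompactSupport fun g : G ↦ φ (g • x) := by
    have h := (hφ.comp_left (g := ((↑) : ℝ → ℂ)) (by simp)).comp_orbitMap (G := G) x
    simpa [Function.comp_def] using h.comp_left (g := Complex.re) (by simp)
  exact Continuous.integral_pos_of_hasCompactSupport_nonneg_nonzero (x := 1) (by fun_prop) hφ'
    (fun g ↦ h0 _) (by simpa using hx)

end Topological

/-- Commutativity turns `g * h` into `h * g`, so left invariance of `μ` suffices. -/
lemma orbitIntegral_smul {G M : Type*} [CommGroup G] [MulAction G M] [MeasurableSpace G]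
    [MeasurableMul G] (μ : Measure G) [μ.IsMulLeftInvariant] (φ : M → ℂ) (h : G) (x : M) :
    orbitIntegral μ φ (h • x) = orbitIntegral μ φ x := by
  simp only [orbitIntegral, smul_smul, mul_comm _ h]
  exact integral_mul_left_eq_self (fun g ↦ φ (g • x)) h

section Smooth

variable {E : Type*} [NormedAddCommGroup E] [NormedSpace ℝ E]
  {M : Type*} [TopologicalSpace M] [ChartedSpace E M] [IsManifold 𝓘(ℝ, E) ∞ M]
  {G : Type*} [TopologicalSpace G]

lemma contDiffOn_smul_charts
    (F : Type*) [NormedAddCommGroup F] [NormedSpace ℝ F] [ChartedSpace F G]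
    [IsManifold 𝓘(ℝ, F) ∞ G] [Group G] [MulAction G M] [ContMDiffSMul 𝓘(ℝ, F) 𝓘(ℝ, E) ∞ G M]
    {φ : M → ℂ}
    (hφ : ContMDiff 𝓘(ℝ, E) 𝓘(ℝ, ℂ) ∞ φ) (x : M) (g : G) :
    ContDiffOn ℝ ∞ (fun z : E × F ↦ φ ((chartAt F g).symm z.2 • (chartAt E x).symm z.1))
      ((chartAt E x).target ×ˢ (chartAt F g).target) := by
  rw [← contMDiffOn_iff_contDiffOn]
  have h1 : ContMDiffOn 𝓘(ℝ, E × F) 𝓘(ℝ, E) ∞ (fun z : E × F ↦ (chartAt E x).symm z.1)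
      ((chartAt E x).target ×ˢ (chartAt F g).target) :=
    (contMDiffOn_chart_symm (I := 𝓘(ℝ, E)) (x := x)).comp contDiff_fst.contMDiff.contMDiffOn
      fun z hz ↦ hz.1
  have h2 : ContMDiffOn 𝓘(ℝ, E × F) 𝓘(ℝ, F) ∞ (fun z : E × F ↦ (chartAt F g).symm z.2)
      ((chartAt E x).target ×ˢ (chartAt F g).target) :=
    (contMDiffOn_chart_symm (I := 𝓘(ℝ, F)) (x := g)).comp contDiff_snd.contMDiff.contMDiffOn
      fun z hz ↦ hz.2
  exact hφ.comp_contMDiffOn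
    ((ContMDiffSMul.contMDiff_smul (I := 𝓘(ℝ, F)) (I' := 𝓘(ℝ, E)) (n := ∞) (G := G)
      (M := M)).comp_contMDiffOn (h2.prodMk h1))

/-- Only `M` is read in a chart while `g` ranges over all of `G`, as integration over a compact
subset of `G` requires. Continuity being local, a chart around each `g` reduces it to the slice
lemma. -/
lemma continuousOn_iteratedFDerivWithin_smul_chart
    (F : Type*) [NormedAddCommGroup F] [NormedSpace ℝ F] [ChartedSpace F G]
    [IsManifold 𝓘(ℝ, F) ∞ G] [Group G] [MulAction G M] [ContMDiffSMul 𝓘(ℝ, F) 𝓘(ℝ, E) ∞ G M]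
    {φ : M → ℂ}
    (hφ : ContMDiff 𝓘(ℝ, E) 𝓘(ℝ, ℂ) ∞ φ) (x : M) (m : ℕ) :
    ContinuousOn (Function.uncurry fun (y : E) (g : G) ↦ iteratedFDerivWithin ℝ m
      (fun y ↦ φ (g • (chartAt E x).symm y)) (chartAt E x).target y)
      ((chartAt E x).target ×ˢ univ) := by
  rintro ⟨y, g⟩ ⟨hy, -⟩
  have hU := (chartAt E x).open_target
  have hT := (chartAt F g).open_target
  have h := (contDiffOn_smul_charts F hφ x g).continuousOn_iteratedFDerivWithin_slice hU hT m
  have hS : (chartAt E x).target ×ˢ (chartAt F g).source ∈ 𝓝 (y, g) :=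
    (hU.prod (chartAt F g).open_source).mem_nhds ⟨hy, mem_chart_source F g⟩
  have hc : ContinuousOn (fun z : E × G ↦ (z.1, chartAt F g z.2))
      ((chartAt E x).target ×ˢ (chartAt F g).source) :=
    continuousOn_fst.prodMk ((chartAt F g).continuousOn.comp continuousOn_snd fun z hz ↦ hz.2)
  have h2 := h.comp hc fun z hz ↦ ⟨hz.1, (chartAt F g).map_source hz.2⟩
  refine ((h2.congr fun z hz ↦ ?_).continuousAt hS).continuousWithinAt
  simp [Function.uncurry, (chartAt F g).left_inv hz.2]

theorem contMDiff_orbitIntegral [FiniteDimensional ℝ E] [T2Space G]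
    (F : Type*) [NormedAddCommGroup F] [NormedSpace ℝ F] [ChartedSpace F G]
    [IsManifold 𝓘(ℝ, F) ∞ G] [Group G] [MulAction G M] [ContMDiffSMul 𝓘(ℝ, F) 𝓘(ℝ, E) ∞ G M]
    [ProperSMul G M] [MeasurableSpace G] [BorelSpace G] (μ : Measure G) [IsFiniteMeasureOnCompacts μ]
    {φ : M → ℂ}
    (hφ : ContMDiff 𝓘(ℝ, E) 𝓘(ℝ, ℂ) ∞ φ) (hs : HasCompactSupport φ) :
    ContMDiff 𝓘(ℝ, E) 𝓘(ℝ, ℂ) ∞ (orbitIntegral μ φ) := by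
  intro x
  have : LocallyCompactSpace M := ChartedSpace.locallyCompactSpace E M
  obtain ⟨K, hK, hxK⟩ := exists_compact_mem_nhds x
  obtain ⟨L, hL, h⟩ := hs.exists_isCompact_smul_eq_zero (G := G) hK
  have hU := (chartAt E x).open_target
  have hp (g : G) : HasFTaylorSeriesUpToOn ∞ (fun y ↦ φ (g • (chartAt E x).symm y))
      (ftaylorSeriesWithin ℝ (fun y ↦ φ (g • (chartAt E x).symm y)) (chartAt E x).target)
      (chartAt E x).target := by
    refine ContDiffOn.ftaylorSeriesWithin ?_ hU.uniqueDiffOn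
    have h := (contDiffOn_smul_charts F hφ x g).comp
      (f := fun y : E ↦ (y, chartAt F g g)) (s := (chartAt E x).target) (by fun_prop)
      fun y hy ↦ ⟨hy, mem_chart_target F g⟩
    simpa [Function.comp_def] using h
  have hI := (hasFTaylorSeriesUpToOn_setIntegral (μ := μ) hL hL.measurableSet hU hp
    fun m ↦ continuousOn_iteratedFDerivWithin_smul_chart F hφ x m).contDiffOn
  have hA := (hI.contDiffAt (hU.mem_nhds (mem_chart_target E x))).contMDiffAt.comp x
    (contMDiffAt_of_mem_maximalAtlas (I := 𝓘(ℝ, E)) (IsManifold.chart_mem_maximalAtlas x)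
      (mem_chart_source E x))
  -- On the neighbourhood `K` of `x` the integrand vanishes off `L`, so the integrals over `L` and
  -- `G` agree there.
  refine hA.congr_of_eventuallyEq ?_
  filter_upwards [hxK, chart_source_mem_nhds E x] with x' hx' hxs
  simp only [Function.comp, (chartAt E x).left_inv hxs, orbitIntegral]
  exact (setIntegral_eq_integral_of_forall_compl_eq_zero fun g hg ↦ h x' hx' g hg).symm

end Smooth

end OrbitIntegral

/-! ### Locally finite families and cutoffs -/

section Locally

/-- A sequence of functions of which at each point one is positive can be replaced by a locally finite
sequence with the same property and constant on the common fibres of the given one. -/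
theorem exists_locallyFinite_of_pos {E : Type*} [NormedAddCommGroup E] [NormedSpace ℝ E]
    {M : Type*} [TopologicalSpace M] [ChartedSpace E M] {a : ℕ → M → ℝ}
    (ha : ∀ i, ContMDiff 𝓘(ℝ, E) 𝓘(ℝ, ℝ) ∞ (a i))
    (hpos : ∀ x, ∃ i, 0 < a i x) :
    ∃ b : ℕ → M → ℝ, (∀ i, ContMDiff 𝓘(ℝ, E) 𝓘(ℝ, ℝ) ∞ (b i)) ∧ (∀ i x, 0 ≤ b i x) ∧
      LocallyFinite (fun i ↦ Function.support (b i)) ∧ (∀ x, ∃ i, 0 < b i x) ∧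
      (∀ i x, 0 < b i x → 0 < a i x) ∧
      ∀ x y, (∀ i, a i x = a i y) → ∀ i, b i x = b i y := by
  -- `expNegInvGlue` is smooth and positive exactly on the positive reals, so `b i x > 0` iff `a i x
  -- > 0` and `a j x < 1 / (i + 1)` for all `j < i`. As `b` is built from the values of `a` alone,
  -- invariance is inherited.
  let b (i : ℕ) (x : M) : ℝ :=
    expNegInvGlue (a i x) * ∏ j ∈ Finset.range i, expNegInvGlue (1 / ((i : ℝ) + 1) - a j x)
  have hb0 (i x) : 0 ≤ b i x :=
    mul_nonneg (expNegInvGlue.nonneg _) (Finset.prod_nonneg fun _ _ ↦ expNegInvGlue.nonneg _)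
  have hglue : ContMDiff 𝓘(ℝ, ℝ) 𝓘(ℝ, ℝ) ∞ expNegInvGlue := expNegInvGlue.contDiff.contMDiff
  refine ⟨b, fun i ↦ ?_, hb0, fun x ↦ ?_, fun x ↦ ?_, fun i x h ↦ ?_, fun x y h i ↦ ?_⟩
  · exact (hglue.comp (ha i)).mul <| contMDiff_finsetProd fun j _ ↦
      hglue.comp (contMDiff_const.sub (ha j))
  · obtain ⟨j, hj⟩ := hpos x
    obtain ⟨N, hN⟩ := exists_nat_one_div_lt (half_pos hj)
    -- On this neighbourhood the `j`-th factor kills `b i` as soon as `i > j` and `i > N`.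
    refine ⟨{y | a j x / 2 < a j y}, (ha j).continuous.continuousAt.eventually_const_lt
      (half_lt_self hj), (finite_Iic (max j N)).subset ?_⟩
    rintro i ⟨y, hy, hy'⟩
    by_contra hi
    rw [mem_Iic, not_le, max_lt_iff] at hi
    refine hy (mul_eq_zero_of_right _ (Finset.prod_eq_zero (Finset.mem_range.2 hi.1) ?_))
    refine expNegInvGlue.zero_of_nonpos ?_
    have h1 : 1 / ((i : ℝ) + 1) ≤ 1 / ((N : ℝ) + 1) :=
      one_div_le_one_div_of_le (by positivity) (by exact_mod_cast Nat.succ_le_succ hi.2.le)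
    have h2 : a j x / 2 < a j y := hy'
    linarith
  · classical
    -- At the first index with `a i x > 0` the earlier values are nonpositive, so no factor
    -- vanishes.
    refine ⟨Nat.find (hpos x), mul_pos (expNegInvGlue.pos_of_pos (Nat.find_spec (hpos x)))
      (Finset.prod_pos fun j hj ↦ expNegInvGlue.pos_of_pos ?_)⟩
    have h1 : a j x ≤ 0 := not_lt.1 (Nat.find_min (hpos x) (Finset.mem_range.1 hj))
    have h2 : 0 < 1 / ((Nat.find (hpos x) : ℝ) + 1) := by positivity
    linarith
  · by_contra h'
    have h1 : b i x = 0 := mul_eq_zero_of_left (expNegInvGlue.zero_of_nonpos (not_lt.1 h')) _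
    exact h.ne' h1
  · simp only [b, h]

/-- A σ-compact manifold has a countable family of nonnegative compactly supported smooth functions
without common zeros. -/
theorem exists_contMDiff_hasCompactSupport_pos {E : Type*} [NormedAddCommGroup E]
    [NormedSpace ℝ E] [FiniteDimensional ℝ E] (M : Type*) [TopologicalSpace M] [T2Space M]
    [SecondCountableTopology M] [ChartedSpace E M] [IsManifold 𝓘(ℝ, E) ∞ M] :
    ∃ φ : ℕ → M → ℝ, (∀ i, ContMDiff 𝓘(ℝ, E) 𝓘(ℝ, ℝ) ∞ (φ i)) ∧
      (∀ i, HasCompactSupport (φ i)) ∧ (∀ i x, 0 ≤ φ i x) ∧ ∀ x, ∃ i, 0 < φ i x := by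
  have : LocallyCompactSpace M := ChartedSpace.locallyCompactSpace E M
  let K : CompactExhaustion M := default
  have h (i : ℕ) : ∃ f : C^∞⟮𝓘(ℝ, E), M; 𝓘(ℝ, ℝ), ℝ⟯, EqOn f 0 (interior (K (i + 1)))ᶜ ∧
      EqOn f 1 (K i) ∧ ∀ x, f x ∈ Icc 0 1 :=
    exists_contMDiffMap_zero_one_of_isClosed 𝓘(ℝ, E) isOpen_interior.isClosed_compl
      (K.isCompact i).isClosed
      (disjoint_compl_left_iff_subset.2 (K.subset_interior_succ i))
  choose f hf0 hf1 hf using h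
  refine ⟨fun i ↦ f i, fun i ↦ (f i).contMDiff, fun i ↦ ?_, fun i x ↦ (hf i x).1, fun x ↦ ?_⟩
  · exact .intro (K.isCompact (i + 1)) fun x hx ↦ hf0 i fun h ↦ hx (interior_subset h)
  · obtain ⟨i, hi⟩ := K.exists_mem x
    exact ⟨i, by simp [hf1 i hi]⟩

end Locally

/-! ### Infinitesimal and global invariance -/

section Connected

variable {F : Type*} [NormedAddCommGroup F] [NormedSpace ℝ F]
  {G : Type*} [TopologicalSpace G] [ChartedSpace F G]

theorem eq_of_mfderiv_eq_zero [PreconnectedSpace G] [IsManifold 𝓘(ℝ, F) ∞ G]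
    {H : Type*} [NormedAddCommGroup H] [NormedSpace ℝ H] {f : G → H}
    (hf : ∀ g, HasMFDerivAt 𝓘(ℝ, F) 𝓘(ℝ, H) f g 0) (g h : G) : f g = f h := by
  suffices IsLocallyConstant f from this.apply_eq_of_preconnectedSpace g h
  refine (IsLocallyConstant.iff_eventually_eq f).2 fun g ↦ ?_
  set c := chartAt F g
  -- A chart target may be disconnected; constancy is obtained on a ball inside it.
  obtain ⟨ε, hε, hb⟩ := Metric.isOpen_iff.1 c.open_target (c g) (mem_chart_target F g)
  have hd : ∀ v ∈ Metric.ball (c g) ε, HasFDerivAt (f ∘ c.symm) (0 : F →L[ℝ] H) v := by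
    intro v hv
    refine hasMFDerivAt_iff_hasFDerivAt.1 ?_
    have h1 : MDifferentiableAt 𝓘(ℝ, F) 𝓘(ℝ, F) c.symm v :=
      ((contMDiffOn_chart_symm (I := 𝓘(ℝ, F)) (n := ∞) (x := g)).contMDiffAt
        (c.open_target.mem_nhds (hb hv))).mdifferentiableAt (by simp)
    have h2 := (hf (c.symm v)).comp v h1.hasMFDerivAt
    exact h2.congr_mfderiv (ContinuousLinearMap.zero_comp _)
  have hn : c ⁻¹' Metric.ball (c g) ε ∈ 𝓝 g :=
    (c.continuousAt (mem_chart_source F g)).preimage_mem_nhds (Metric.ball_mem_nhds _ hε)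
  filter_upwards [hn, chart_source_mem_nhds F g] with g' hg' hs
  have := Metric.isOpen_ball.is_const_of_fderiv_eq_zero (convex_ball (c g) ε).isPreconnected
    (fun v hv ↦ (hd v hv).differentiableAt.differentiableWithinAt)
    (fun v hv ↦ (hd v hv).fderiv) hg' (Metric.mem_ball_self hε)
  simpa [c, c.left_inv hs] using this

end Connected

section Invariance

variable {E : Type*} [NormedAddCommGroup E] [NormedSpace ℝ E]
  {M : Type*} [TopologicalSpace M] [ChartedSpace E M]
  {F : Type*} [NormedAddCommGroup F] [NormedSpace ℝ F]
  {G : Type*} [TopologicalSpace G] [ChartedSpace F G] [Group G] [MulAction G M]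

lemma SmoothFun.infinitesimalAction_eq_zero {f : SmoothFun E M}
    (hf : ∀ (g : G) x, (f : M → ℂ) (g • x) = (f : M → ℂ) x)
    (ξ : GroupLieAlgebra 𝓘(ℝ, F) G) (x : M) : SmoothFun.infinitesimalAction f ξ x = 0 := by
  have h : (fun g : G ↦ (f : M → ℂ) (g • x)) = fun _ ↦ (f : M → ℂ) x := funext fun g ↦ hf g x
  rw [infinitesimalAction, h, mfderiv_const]
  rfl

/-- A smooth function annihilated by the Lie algebra is invariant under a connected group. -/
theorem SmoothFun.smul_eq_of_infinitesimalAction_eq_zero [PreconnectedSpace G]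
    [LieGroup 𝓘(ℝ, F) ∞ G] [ContMDiffSMul 𝓘(ℝ, F) 𝓘(ℝ, E) ∞ G M] {f : SmoothFun E M}
    (hf : ∀ (ξ : GroupLieAlgebra 𝓘(ℝ, F) G) x, SmoothFun.infinitesimalAction f ξ x = 0)
    (g : G) (x : M) : (f : M → ℂ) (g • x) = (f : M → ℂ) x := by
  have hsmooth (y : M) : ContMDiff 𝓘(ℝ, F) 𝓘(ℝ, ℂ) ∞ fun g : G ↦ (f : M → ℂ) (g • y) :=
    ContMDiff.comp (I' := 𝓘(ℝ, E)) f.2 <| (ContMDiffSMul.contMDiff_smul (I := 𝓘(ℝ, F))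
      (I' := 𝓘(ℝ, E)) (n := ∞) (G := G) (M := M)).comp (contMDiff_id.prodMk contMDiff_const)
  have h1 (y : M) : HasMFDerivAt 𝓘(ℝ, F) 𝓘(ℝ, ℂ) (fun g : G ↦ (f : M → ℂ) (g • y)) 1 0 := by
    refine (((hsmooth y).mdifferentiable (by simp)) 1).hasMFDerivAt.congr_mfderiv ?_
    exact ContinuousLinearMap.ext fun ξ ↦ hf ξ y
  -- Right translation by `g⁻¹` carries the orbit map of `x` at `g` to the orbit map of `g • x` at
  -- 1, so vanishing at 1 for every base point suffices.
  have hall (g : G) :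
      HasMFDerivAt 𝓘(ℝ, F) 𝓘(ℝ, ℂ) (fun g : G ↦ (f : M → ℂ) (g • x)) g 0 := by
    have hm : MDifferentiableAt 𝓘(ℝ, F) 𝓘(ℝ, F) (· * g⁻¹) g :=
      (contMDiff_mul_right (I := 𝓘(ℝ, F)) (n := ∞) (a := g⁻¹)).mdifferentiable (by simp) g
    have h := h1 (g • x)
    rw [← mul_inv_cancel g] at h
    have h2 := HasMFDerivAt.comp g h hm.hasMFDerivAt
    have h3 : (fun g : G ↦ (f : M → ℂ) (g • x)) =
        (fun h : G ↦ (f : M → ℂ) (h • g • x)) ∘ (· * g⁻¹) := by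
      ext; simp [mul_smul]
    rw [h3]
    exact h2.congr_mfderiv (ContinuousLinearMap.zero_comp _)
  simpa using eq_of_mfderiv_eq_zero (F := F) hall g 1

end Invariance

/-! ### Weights and the averaging operator -/

section Average

lemma orbitIntegral_ofReal {G M : Type*} [SMul G M] [MeasurableSpace G] (μ : Measure G)
    (φ : M → ℝ) (x : M) :
    orbitIntegral μ (fun x ↦ (φ x : ℂ)) x = (∫ g, φ (g • x) ∂μ : ℝ) :=
  integral_complex_ofReal

variable {E : Type*} [NormedAddCommGroup E] [NormedSpace ℝ E] {M : Type*} [TopologicalSpace M]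
  [ChartedSpace E M] {G : Type*} [MeasurableSpace G]

/-- Weights for averaging functions over the orbits of a group action. -/
structure AveragingWeights (E M : Type*) [NormedAddCommGroup E] [NormedSpace ℝ E]
    [TopologicalSpace M] [ChartedSpace E M] {G : Type*} [SMul G M] [MeasurableSpace G]
    (μ : Measure G) where
  /-- the compactly supported functions along which orbits are integrated -/
  cutoff : ℕ → M → ℝ
  /-- the invariant weights -/
  weight : ℕ → M → ℝ
  contMDiff_cutoff (i : ℕ) : ContMDiff 𝓘(ℝ, E) 𝓘(ℝ, ℝ) ∞ (cutoff i)
  hasCompactSupport_cutoff (i : ℕ) : HasCompactSupport (cutoff i)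
  cutoff_nonneg (i : ℕ) (x : M) : 0 ≤ cutoff i x
  contMDiff_weight (i : ℕ) : ContMDiff 𝓘(ℝ, E) 𝓘(ℝ, ℝ) ∞ (weight i)
  weight_nonneg (i : ℕ) (x : M) : 0 ≤ weight i x
  locallyFinite : LocallyFinite fun i ↦ Function.support (weight i)
  weight_smul (i : ℕ) (g : G) (x : M) : weight i (g • x) = weight i x
  finsum_eq_one (x : M) : ∑ᶠ i, weight i x * ∫ g : G, cutoff i (g • x) ∂μ = 1

/-- The orbit integrals `a i` of the cutoffs are invariant and have no common zero, but their
supports need not be locally finite. They are replaced by the locally finite `b i`, and `b i / D`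
with `D = ∑ᶠ i, b i * a i` is normalized. -/
theorem AveragingWeights.nonempty [FiniteDimensional ℝ E] [T2Space M] [SecondCountableTopology M]
    [IsManifold 𝓘(ℝ, E) ∞ M] (F : Type*) [NormedAddCommGroup F] [NormedSpace ℝ F]
    [TopologicalSpace G] [T2Space G] [ChartedSpace F G] [IsManifold 𝓘(ℝ, F) ∞ G] [CommGroup G]
    [IsTopologicalGroup G] [MulAction G M] [ContMDiffSMul 𝓘(ℝ, F) 𝓘(ℝ, E) ∞ G M] [ProperSMul G M]
    [BorelSpace G] (μ : Measure G) [μ.IsHaarMeasure] :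
    Nonempty (AveragingWeights E M μ) := by
  obtain ⟨φ, hφ, hφc, hφ0, hφpos⟩ := exists_contMDiff_hasCompactSupport_pos (E := E) M
  have hφ' (i : ℕ) : ContMDiff 𝓘(ℝ, E) 𝓘(ℝ, ℂ) ∞ fun x ↦ (φ i x : ℂ) :=
    Complex.ofRealCLM.contDiff.contMDiff.comp (hφ i)
  have hφc' (i : ℕ) : HasCompactSupport fun x ↦ (φ i x : ℂ) :=
    (hφc i).comp_left (g := ((↑) : ℝ → ℂ)) (by simp)
  let a (i : ℕ) (x : M) : ℝ := ∫ g : G, φ i (g • x) ∂μ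
  have ha (i : ℕ) : ContMDiff 𝓘(ℝ, E) 𝓘(ℝ, ℝ) ∞ (a i) := by
    refine (Complex.reCLM.contDiff.contMDiff.comp
      (contMDiff_orbitIntegral F μ (hφ' i) (hφc' i))).congr fun x ↦ ?_
    simp [a, orbitIntegral_ofReal]
  have ha0 (i : ℕ) (x : M) : 0 ≤ a i x := integral_nonneg fun g ↦ hφ0 i _
  have hainv (i : ℕ) (g : G) (x : M) : a i (g • x) = a i x := by
    have h := orbitIntegral_smul μ (fun x ↦ (φ i x : ℂ)) g x
    rw [orbitIntegral_ofReal, orbitIntegral_ofReal] at h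
    exact_mod_cast h
  obtain ⟨b, hb, hb0, hbf, hbpos, hba, hbinv⟩ := exists_locallyFinite_of_pos ha fun x ↦
    (hφpos x).imp fun i hi ↦ orbitIntegral_ofReal_pos μ (hφ i).continuous (hφc i) (hφ0 i) hi.ne'
  have hbf' : LocallyFinite fun i ↦ Function.support fun x ↦ b i x * a i x :=
    hbf.subset fun i ↦ Function.support_mul_subset_left _ _
  let D (x : M) : ℝ := ∑ᶠ i, b i x * a i x
  have hD : ContMDiff 𝓘(ℝ, E) 𝓘(ℝ, ℝ) ∞ D := contMDiff_finsum (fun i ↦ (hb i).mul (ha i)) hbf'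
  have hDpos (x : M) : 0 < D x := by
    obtain ⟨i, hi⟩ := hbpos x
    -- `b i x > 0` forces `a i x > 0`, so the product has a positive term.
    exact finsum_pos (fun i ↦ mul_nonneg (hb0 i x) (ha0 i x)) ⟨i, mul_pos hi (hba i x hi)⟩
      (hbf'.point_finite x)
  have hbinv' (i : ℕ) (g : G) (x : M) : b i (g • x) = b i x :=
    hbinv _ _ (fun i ↦ hainv i g x) i
  refine ⟨⟨φ, fun i x ↦ b i x / D x, hφ, hφc, hφ0, fun i ↦ (hb i).div₀ hD fun x ↦ (hDpos x).ne',
    fun i x ↦ div_nonneg (hb0 i x) (hDpos x).le, hbf.subset fun i x hx h ↦ hx (by simp [h]),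
    fun i g x ↦ by simp [D, hbinv', hainv], fun x ↦ ?_⟩⟩
  have h : ∑ᶠ i, b i x / D x * a i x = (∑ᶠ i, b i x * a i x) * (D x)⁻¹ := by
    rw [finsum_mul]
    exact finsum_congr fun i ↦ by ring
  exact h.trans (mul_inv_cancel₀ (hDpos x).ne')

namespace AveragingWeights

variable {μ : Measure G}

section SMul

variable [SMul G M] (W : AveragingWeights E M μ)

/-- The average of a function over orbits. -/
noncomputable def average (f : M → ℂ) (x : M) : ℂ :=
  ∑ᶠ i, (W.weight i x : ℂ) * orbitIntegral μ (fun x ↦ W.cutoff i x * f x) x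

lemma finite_support (x : M) (c : ℕ → ℂ) :
    (Function.support fun i ↦ (W.weight i x : ℂ) * c i).Finite :=
  (W.locallyFinite.point_finite x).subset fun i hi h ↦ hi (by simp [h])

lemma finite_support_real (x : M) (c : ℕ → ℝ) :
    (Function.support fun i ↦ W.weight i x * c i).Finite :=
  (W.locallyFinite.point_finite x).subset fun i hi h ↦ hi (by simp [h])

lemma average_const_mul (c : ℂ) (f : M → ℂ) (x : M) :
    W.average (fun x ↦ c * f x) x = c * W.average f x := by
  rw [average, average, mul_finsum]
  refine finsum_congr fun i ↦ ?_
  simp only [orbitIntegral, mul_left_comm _ c, integral_const_mul]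

/-- Gives both reality and positivity of the averaging operator. -/
lemma average_ofReal (r : M → ℝ) (x : M) : W.average (fun x ↦ (r x : ℂ)) x =
    (∑ᶠ i, W.weight i x * ∫ g : G, W.cutoff i (g • x) * r (g • x) ∂μ : ℝ) := by
  have h := map_finsum Complex.ofRealHom
    (W.finite_support_real x fun i ↦ ∫ g : G, W.cutoff i (g • x) * r (g • x) ∂μ)
  refine Eq.trans (finsum_congr fun i ↦ ?_) h.symm
  have hi := orbitIntegral_ofReal μ (fun x ↦ W.cutoff i x * r x) x
  push_cast at hi
  simp [hi]

lemma contMDiff_mul {f : M → ℂ} (hf : ContMDiff 𝓘(ℝ, E) 𝓘(ℝ, ℂ) ∞ f) (i : ℕ) :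
    ContMDiff 𝓘(ℝ, E) 𝓘(ℝ, ℂ) ∞ fun x ↦ (W.cutoff i x : ℂ) * f x :=
  (contDiff_mul (𝕜 := ℝ) (𝔸 := ℂ)).contMDiff.comp
    ((Complex.ofRealCLM.contDiff.contMDiff.comp (W.contMDiff_cutoff i)).prodMk_space hf)

lemma hasCompactSupport_mul (f : M → ℂ) (i : ℕ) :
    HasCompactSupport fun x ↦ (W.cutoff i x : ℂ) * f x :=
  ((W.hasCompactSupport_cutoff i).comp_left (g := ((↑) : ℝ → ℂ)) (by simp)).mul_right

lemma average_eq_self {f : M → ℂ} (hf : ∀ (g : G) x, f (g • x) = f x) (x : M) :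
    W.average f x = f x := by
  -- An invariant `f` is constant along the orbit and factors out, leaving the average of 1; the
  -- cast from `ℝ` lets `average_ofReal` apply.
  have h (i : ℕ) : (W.weight i x : ℂ) * orbitIntegral μ (fun x ↦ W.cutoff i x * f x) x =
      f x * ((W.weight i x : ℂ) * orbitIntegral μ (fun x ↦ W.cutoff i x * ((1 : ℝ) : ℂ)) x) := by
    simp only [orbitIntegral, hf, integral_mul_const, integral_complex_ofReal]
    push_cast
    ring
  rw [average, finsum_congr h, ← mul_finsum]
  have h1 := W.average_ofReal (fun _ ↦ 1) x
  simp only [mul_one, W.finsum_eq_one] at h1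
  simpa [average] using congrArg (f x * ·) h1

end SMul

lemma average_smul [CommGroup G] [MulAction G M] [MeasurableMul G] [μ.IsMulLeftInvariant]
    (W : AveragingWeights E M μ) (f : M → ℂ) (g : G) (x : M) :
    W.average f (g • x) = W.average f x := by
  simp only [average, W.weight_smul, orbitIntegral_smul]

variable [TopologicalSpace G] [T2Space G] [BorelSpace G] [Group G] [MulAction G M]
  [ProperSMul G M] (W : AveragingWeights E M μ)

lemma average_add [IsFiniteMeasureOnCompacts μ] {f h : M → ℂ}
    (hf : ContMDiff 𝓘(ℝ, E) 𝓘(ℝ, ℂ) ∞ f) (hh : ContMDiff 𝓘(ℝ, E) 𝓘(ℝ, ℂ) ∞ h) (x : M) :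
    W.average (fun x ↦ f x + h x) x = W.average f x + W.average h x := by
  rw [average, average, average, ← finsum_add_distrib (W.finite_support x _) (W.finite_support x _)]
  refine finsum_congr fun i ↦ ?_
  rw [← mul_add, orbitIntegral, orbitIntegral, orbitIntegral, ← integral_add
    (orbitIntegrable μ (W.contMDiff_mul hf i).continuous (W.hasCompactSupport_mul f i) x)
    (orbitIntegrable μ (W.contMDiff_mul hh i).continuous (W.hasCompactSupport_mul h i) x)]
  simp only [mul_add]

theorem contMDiff_average [FiniteDimensional ℝ E] [IsManifold 𝓘(ℝ, E) ∞ M] (F : Type*)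
    [NormedAddCommGroup F] [NormedSpace ℝ F] [ChartedSpace F G] [IsManifold 𝓘(ℝ, F) ∞ G]
    [ContMDiffSMul 𝓘(ℝ, F) 𝓘(ℝ, E) ∞ G M] [IsFiniteMeasureOnCompacts μ] {f : M → ℂ}
    (hf : ContMDiff 𝓘(ℝ, E) 𝓘(ℝ, ℂ) ∞ f) : ContMDiff 𝓘(ℝ, E) 𝓘(ℝ, ℂ) ∞ (W.average f) := by
  refine contMDiff_finsum (fun i ↦ ?_) ?_
  · exact (contDiff_mul (𝕜 := ℝ) (𝔸 := ℂ)).contMDiff.comp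
      ((Complex.ofRealCLM.contDiff.contMDiff.comp (W.contMDiff_weight i)).prodMk_space
        (contMDiff_orbitIntegral F μ (W.contMDiff_mul hf i) (W.hasCompactSupport_mul f i)))
  · exact W.locallyFinite.subset fun i x hx h ↦ hx (by simp [h])

theorem exists_linearMap_average [FiniteDimensional ℝ E] [IsManifold 𝓘(ℝ, E) ∞ M] (F : Type*)
    [NormedAddCommGroup F] [NormedSpace ℝ F] [ChartedSpace F G] [IsManifold 𝓘(ℝ, F) ∞ G]
    [ContMDiffSMul 𝓘(ℝ, F) 𝓘(ℝ, E) ∞ G M] [IsFiniteMeasureOnCompacts μ] :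
    ∃ T : SmoothFun E M →ₗ[ℂ] SmoothFun E M, ∀ f : SmoothFun E M, (T f : M → ℂ) = W.average f :=
  ⟨{  toFun f := ⟨W.average f, W.contMDiff_average F f.2⟩
      map_add' f h := Subtype.ext <| funext fun x ↦ W.average_add f.2 h.2 x
      map_smul' c f := Subtype.ext <| funext fun x ↦ W.average_const_mul c f x }, fun _ ↦ rfl⟩

end AveragingWeights

end Average

/-! ### The averaging operator on the Poisson manifold -/

theorem proposition4p4
    -- the smooth manifold `M`
    {E : Type*} [NormedAddCommGroup E] [NormedSpace ℝ E] [FiniteDimensional ℝ E]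
    {M : Type*} [TopologicalSpace M] [T2Space M] [SecondCountableTopology M]
    [ChartedSpace E M] [IsManifold 𝓘(ℝ, E) ∞ M]
    -- its Poisson bracket
    (π : PoissonBracket (SmoothFun E M))
    -- the connected abelian Lie group `G`
    {F : Type*} [NormedAddCommGroup F] [NormedSpace ℝ F] [FiniteDimensional ℝ F]
    {G : Type*} [TopologicalSpace G] [T2Space G] [ConnectedSpace G]
    [ChartedSpace F G] [CommGroup G] [LieGroup 𝓘(ℝ, F) ∞ G]
    -- its smooth left action on `M`
    [MulAction G M] [ContMDiffSMul 𝓘(ℝ, F) 𝓘(ℝ, E) ∞ G M]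
    -- a momentum map that induces the infinitesimal action
    (J : MomentumMap (SmoothFun.representablePoisson π) (GroupLieAlgebra 𝓘(ℝ, F) G))
    (hJ : ∀ (f : SmoothFun E M) (ξ : GroupLieAlgebra 𝓘(ℝ, F) G) (x : M),
      SmoothFun.infinitesimalAction f ξ x = (J.act f ξ : M → ℂ) x)
    -- properness of the action
    [ProperSMul G M] :
    ∃ av : SmoothFun E M →ₗ[ℂ] J.invariants, IsAveragingOperator J av := by
  have : IsManifold 𝓘(ℝ, F) ∞ G := ContMDiffMul.toIsManifold
  have : IsTopologicalGroup G := topologicalGroup_of_lieGroup 𝓘(ℝ, F) ∞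
  have : LocallyCompactSpace G := ChartedSpace.locallyCompactSpace F G
  let : MeasurableSpace G := borel G
  have : BorelSpace G := ⟨rfl⟩
  let μ : Measure G := Measure.haar
  obtain ⟨W⟩ := AveragingWeights.nonempty (E := E) (M := M) F μ
  obtain ⟨T, hT⟩ := W.exists_linearMap_average F
  have hmem (f : SmoothFun E M) : T f ∈ J.invariants := fun ξ ↦ by
    ext x
    rw [← hJ, SmoothFun.infinitesimalAction_eq_zero]
    · rfl
    · intro g x
      simp only [hT, W.average_smul]
  have hreal {f : SmoothFun E M} (hf : ∀ x, ((f : M → ℂ) x).im = 0) :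
      (f : M → ℂ) = fun x ↦ ((((f : M → ℂ) x).re : ℝ) : ℂ) :=
    funext fun x ↦ Complex.ext rfl (by simp [hf])
  refine ⟨T.codRestrict J.invariants.toSubalgebra.toSubmodule hmem, fun a ↦ ?_, fun f hf ↦ ?_,
    fun f hf x ↦ ?_⟩
  · have ha (g : G) (x : M) : ((a : SmoothFun E M) : M → ℂ) (g • x) = (a : SmoothFun E M).1 x := by
      refine SmoothFun.smul_eq_of_infinitesimalAction_eq_zero (F := F) (fun ξ x ↦ ?_) g x
      rw [hJ, a.2 ξ]
      rfl
    refine Subtype.ext (Subtype.ext ?_)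
    change (T a : M → ℂ) = _
    rw [hT]
    exact funext (W.average_eq_self ha)
  · have hf' (x : M) : ((f : M → ℂ) x).im = 0 :=
      Complex.conj_eq_iff_im.1 (congrArg (fun g : SmoothFun E M ↦ (g : M → ℂ) x) hf.star_eq)
    refine Subtype.ext (Subtype.ext (funext fun x ↦ ?_))
    change star ((T f : M → ℂ) x) = (T f : M → ℂ) x
    rw [hT, hreal hf', W.average_ofReal]
    exact Complex.conj_ofReal _
  · change ((T f : M → ℂ) x).im = 0 ∧ 0 ≤ ((T f : M → ℂ) x).re
    rw [hT, hreal fun x ↦ (hf x).1, W.average_ofReal]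
    refine ⟨Complex.ofReal_im _, finsum_nonneg fun i ↦ mul_nonneg (W.weight_nonneg i x) ?_⟩
    exact integral_nonneg fun g ↦ mul_nonneg (W.cutoff_nonneg i _) (hf _).2
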